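/- **Conventions.** Formulas are built from countably many variables $x_0,x_1,\dots$ by $\wedge,\vee,\neg$. A *logic* is a substitution-invariant consequence relation $\Gamma\vdash\varphi$ between (possibly infinite) sets of formulas and formulas; $\mathcal L'$ *extends* $\mathcal L$ if every rule valid in $\mathcal L$ is valid in $\mathcal L'$. The *extension of $\mathcal L$ by a set of rules* is the smallest logic that extends $\mathcal L$ and validates these rules. A *De Morgan lattice* is a (not necessarily bounded) distributive lattice with a unary operation $\neg$ satisfying $\neg\neg x=x$, $\neg(x\vee y)=\neg x\wedge\neg y$, $\neg(x\wedge y)=\neg x\vee\neg y$. A structure $\langle\mathbf A,F\rangle$, where $\mathbf A$ is a De Morgan lattice and $F$ is an upset of $\mathbf A$, satisfies $\Gamma\vdash\varphi$ if every valuation in $\mathbf A$ sending all of $\Gamma$ into $F$ sends $\varphi$ into $F$; the logic determined by a class of such structures consists of the rules satisfied by all of them, and a structure is a *model* of $\mathcal L$ if it satisfies all rules valid in $\mathcal L$. $\mathrm{BD}_\infty$ is the logic determined by all such structures, and a *finitely generated extension* of $\mathrm{BD}_\infty$ is a logic determined by a finite set of finite such structures. A logic has the *proof by cases property (PCP)*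 if $\Gamma,\varphi_1\vdash\psi$ and $\Gamma,\varphi_2\vdash\psi$ imply $\Gamma,\varphi_1\vee\varphi_2\vdash\psi$. For $n\ge1$ the *$n$-adjunction rule* is $\{\bigwedge_{j\ne i}x_j : 1\le i\le n+1\}\vdash x_1\wedge\dots\wedge x_{n+1}$. The *disjunctive variant* of a finitary rule $\Gamma\vdash\varphi$ is $\{\gamma\vee x:\gamma\in\Gamma\}\vdash\varphi\vee x$, where $x$ is a variable not occurring in $\Gamma\vdash\varphi$. Let $\mathbf{DM}_1$ be the four-element De Morgan lattice $\{\mathsf t,\mathsf b,\mathsf n,\mathsf f\}$ with bottom $\mathsf f$, top $\mathsf t$, incomparable $\mathsf n,\mathsf b$, and $\neg\mathsf t=\mathsf f$, $\neg\mathsf n=\mathsf n$, $\neg\mathsf b=\mathsf b$. Let $\mathbb{DM}_n$ be the structure on $(\mathbf{DM}_1)^n$ in which a tuple is designated iff some component is in $\{\mathsf t,\mathsf b\}$. A set $R$ of finitary rules is *separating* for $\mathcal L$ at level $n$ if every rule in $R$ is valid in $\mathcal L$ and fails in some substructure of $\mathbb{DM}_n$ that is not a model of $\mathcal L$, and in every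 substructure of $\mathbb{DM}_n$ that is not a model of $\mathcal L$ some rule in $R$ fails. **Theorem (Finite basis theorem for finitely generated logics of prime upsets).** Every finitely generated extension $\mathcal L$ of $\mathrm{BD}_\infty$ with the PCP has a finite Hilbert-style axiomatization. More precisely, there are an $n\ge1$ and a finite set $R$ of finitary rules, separating for $\mathcal L$ at level $n$, such that $\mathcal L$ is the extension of $\mathrm{BD}_\infty$ by the $n$-adjunction rule and the disjunctive variants of the rules in $R$. Moreover, there is a finite set $B$ of finitary rules such that $\mathrm{BD}_\infty$ is the derivability relation of the Hilbert-style calculus with the rules $B$, and $\mathcal L$ is the derivability relation of the Hilbert-style calculus whose rules are those in $B$, the $n$-adjunction rule and the disjunctive variants of the rules in $R$. -/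

import Mathlib

namespace DML

/-! ## Formulas, substitutions and finitary rules -/

/-- Formulas in the signature of De Morgan lattices over a countably infinite set of variables. -/
inductive Formula : Type
  | var : ℕ → Formula
  | conj : Formula → Formula → Formula
  | disj : Formula → Formula → Formula
  | neg : Formula → Formula
  deriving DecidableEq

namespace Formula

/-- Simultaneous substitution. -/
def subst (σ : ℕ → Formula) : Formula → Formula
  | var i => σ i
  | conj φ ψ => conj (φ.subst σ) (ψ.subst σ)
  | disj φ ψ => disj (φ.subst σ) (ψ.subst σ)
  | neg φ => neg (φ.subst σ)

/-- The set of variables occurring in a formula. -/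
def vars : Formula → Finset ℕ
  | var i => {i}
  | conj φ ψ => φ.vars ∪ ψ.vars
  | disj φ ψ => φ.vars ∪ ψ.vars
  | neg φ => φ.vars

/-- The conjunction of a non-empty list of formulas. The value on the empty list is arbitrary. -/
def bigConj : List Formula → Formula
  | [] => var 0
  | [φ] => φ
  | φ :: ψ :: l => conj φ (bigConj (ψ :: l))

end Formula

/-- A finitary rule `Γ ⊢ φ`: the set of premises `Γ` is finite (possibly empty). -/
structure Rule : Type where
  premises : Finset Formula
  conclusion : Formula

namespace Rule

/-- The set of variables occurring in a rule. -/
def vars (r : Rule) : Finset ℕ := r.premises.biUnion Formula.vars ∪ r.conclusion.vars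

/-- A variable which does not occur in the rule. -/
def freshVar (r : Rule) : ℕ := r.vars.sup id + 1

theorem freshVar_notMem_vars (r : Rule) : r.freshVar ∉ r.vars := by
  intro h
  have h1 : id r.freshVar ≤ r.vars.sup id := Finset.le_sup h
  simp only [freshVar, id_eq] at h1
  omega

/-- The disjunctive variant `{γ ∨ x | γ ∈ Γ} ⊢ φ ∨ x` of a finitary rule `Γ ⊢ φ`, where the
variable `x` does not occur in `Γ ⊢ φ`. -/
def disjVariant (r : Rule) : Rule where
  premises := r.premises.image fun γ => Formula.disj γ (Formula.var r.freshVar)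
  conclusion := Formula.disj r.conclusion (Formula.var r.freshVar)

/-- The `n`-adjunction rule (for `1 ≤ n`), in the `n + 1` variables `x₀, …, xₙ`: the premises are
the `n + 1` submeets of `x₀ ∧ … ∧ xₙ` which omit one of the variables, the conclusion is
`x₀ ∧ … ∧ xₙ`. -/
def nAdjunction (n : ℕ) : Rule where
  premises := (Finset.range (n + 1)).image fun i =>
    Formula.bigConj (((List.range (n + 1)).map Formula.var).eraseIdx i)
  conclusion := Formula.bigConj ((List.range (n + 1)).map Formula.var)

end Rule

/-! ## Logics -/

/-- A (not necessarily finitary) logic: a substitution-invariant consequence relation between sets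
of formulas and formulas. -/
@[ext]
structure Logic : Type where
  Entails : Set Formula → Formula → Prop
  refl : ∀ {Γ : Set Formula} {φ : Formula}, φ ∈ Γ → Entails Γ φ
  mono : ∀ {Γ Δ : Set Formula} {φ : Formula}, Γ ⊆ Δ → Entails Γ φ → Entails Δ φ
  cut : ∀ {Γ Δ : Set Formula} {φ : Formula},
    (∀ δ ∈ Δ, Entails Γ δ) → Entails Δ φ → Entails Γ φ
  structural : ∀ {Γ : Set Formula} {φ : Formula} (σ : ℕ → Formula),
    Entails Γ φ → Entails (Formula.subst σ '' Γ) (φ.subst σ)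

namespace Logic

/-- `L ≤ L'` means that `L'` is an extension of `L`. -/
instance : LE Logic where
  le L L' := ∀ (Γ : Set Formula) (φ : Formula), L.Entails Γ φ → L'.Entails Γ φ

/-- The rule is valid in the logic. -/
def Validates (L : Logic) (r : Rule) : Prop := L.Entails (r.premises : Set Formula) r.conclusion

/-- The proof by cases property. -/
def PCP (L : Logic) : Prop :=
  ∀ (Γ : Set Formula) (φ₁ φ₂ ψ : Formula),
    L.Entails (insert φ₁ Γ) ψ → L.Entails (insert φ₂ Γ) ψ →
      L.Entails (insert (Formula.disj φ₁ φ₂) Γ) ψ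

/-- The extension of the logic `L` by a set of rules `R`: the smallest logic which extends `L` and
validates each rule in `R`. -/
def extendBy (L : Logic) (R : Set Rule) : Logic where
  Entails Γ φ := ∀ L' : Logic, L ≤ L' → (∀ r ∈ R, L'.Validates r) → L'.Entails Γ φ
  refl h := fun L' _ _ => L'.refl h
  mono h h' := fun L' hL hR => L'.mono h (h' L' hL hR)
  cut h h' := fun L' hL hR => L'.cut (fun δ hδ => h δ hδ L' hL hR) (h' L' hL hR)
  structural σ h := fun L' hL hR => L'.structural σ (h L' hL hR)

end Logic

/-- Derivability of a formula from the set of premises `Γ` in the Hilbert-style calculus given by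
the set of finitary rules `H` (axioms are rules without premises). -/
inductive HilbertDerivable (H : Set Rule) (Γ : Set Formula) : Formula → Prop
  | premise {φ : Formula} : φ ∈ Γ → HilbertDerivable H Γ φ
  | apply (r : Rule) (σ : ℕ → Formula) : r ∈ H →
      (∀ γ ∈ r.premises, HilbertDerivable H Γ (γ.subst σ)) →
      HilbertDerivable H Γ (r.conclusion.subst σ)

/-- `H` is a Hilbert-style axiomatization of the logic `L`. -/
def Logic.IsAxiomatizedBy (L : Logic) (H : Set Rule) : Prop :=
  ∀ (Γ : Set Formula) (φ : Formula), L.Entails Γ φ ↔ HilbertDerivable H Γ φ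

/-! ## De Morgan lattices and structures -/

/-- De Morgan lattices: distributive lattices (not necessarily bounded) with an involution which
satisfies the De Morgan laws. -/
class DeMorganLattice (α : Type) extends DistribLattice α where
  dneg : α → α
  dneg_dneg : ∀ x : α, dneg (dneg x) = x
  dneg_sup : ∀ x y : α, dneg (x ⊔ y) = dneg x ⊓ dneg y
  dneg_inf : ∀ x y : α, dneg (x ⊓ y) = dneg x ⊔ dneg y

/-- The value of a formula under a valuation in a De Morgan lattice. -/
def Formula.eval {α : Type} [DeMorganLattice α] (v : ℕ → α) : Formula → α
  | .var i => v i
  | .conj φ ψ => φ.eval v ⊓ ψ.eval v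
  | .disj φ ψ => φ.eval v ⊔ ψ.eval v
  | .neg φ => DeMorganLattice.dneg (φ.eval v)

theorem Formula.eval_subst {α : Type} [DeMorganLattice α] (v : ℕ → α) (σ : ℕ → Formula)
    (φ : Formula) : (φ.subst σ).eval v = φ.eval fun i => (σ i).eval v := by
  induction φ with
  | var i => rfl
  | conj φ ψ hφ hψ => simp only [Formula.subst, Formula.eval, hφ, hψ]
  | disj φ ψ hφ hψ => simp only [Formula.subst, Formula.eval, hφ, hψ]
  | neg φ hφ => simp only [Formula.subst, Formula.eval, hφ]

/-- Structures `⟨A, F⟩` where `A` is a (non-empty) De Morgan lattice and the designated set `F` is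
an upset of `A`. -/
structure UpsetStructure : Type 1 where
  carrier : Type
  [lattice : DeMorganLattice carrier]
  [nonempty : Nonempty carrier]
  designated : UpperSet carrier

attribute [instance] UpsetStructure.lattice UpsetStructure.nonempty

namespace UpsetStructure

/-- The (possibly infinitary) rule `Γ ⊢ φ` holds in the structure. -/
def Satisfies (M : UpsetStructure) (Γ : Set Formula) (φ : Formula) : Prop :=
  ∀ v : ℕ → M.carrier, (∀ γ ∈ Γ, γ.eval v ∈ M.designated) → φ.eval v ∈ M.designated

/-- The structure is a model of the logic. -/
def IsModel (M : UpsetStructure) (L : Logic) : Prop :=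
  ∀ (Γ : Set Formula) (φ : Formula), L.Entails Γ φ → M.Satisfies Γ φ

end UpsetStructure

/-- The logic determined by a class of structures. -/
def logicOf (K : Set UpsetStructure) : Logic where
  Entails Γ φ := ∀ M ∈ K, M.Satisfies Γ φ
  refl h := fun _ _ _ hv => hv _ h
  mono h h' := fun M hM v hv => h' M hM v fun γ hγ => hv γ (h hγ)
  cut h h' := fun M hM v hv => h' M hM v fun δ hδ => h δ hδ M hM v hv
  structural σ h := fun M hM v hv => by
    rw [Formula.eval_subst]
    refine h M hM _ fun γ hγ => ?_
    rw [← Formula.eval_subst]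
    exact hv _ (Set.mem_image_of_mem _ hγ)

/-- The logic `BD_∞` of all upsets of De Morgan lattices. -/
def BDinf : Logic := logicOf Set.univ

/-- `L` is a finitely generated extension of `BD_∞`: it is the logic determined by a finite set of
finite structures consisting of a De Morgan lattice with a designated upset. -/
def Logic.IsFinitelyGenerated (L : Logic) : Prop :=
  ∃ K : Set UpsetStructure, K.Finite ∧ (∀ M ∈ K, Finite M.carrier) ∧ L = logicOf K

/-! ## The structures `DM₁^{⊗ n}` and their substructures -/

/-- The four-element De Morgan lattice. -/
def DM : Type := Bool × Bool

namespace DM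

/-- The top element. -/
def t : DM := (true, true)
/-- The designated fixpoint of the negation. -/
def b : DM := (true, false)
/-- The undesignated fixpoint of the negation. -/
def n : DM := (false, true)
/-- The bottom element. -/
def f : DM := (false, false)

instance : DecidableEq DM := inferInstanceAs (DecidableEq (Bool × Bool))

instance : DistribLattice DM := inferInstanceAs (DistribLattice (Bool × Bool))

instance : DeMorganLattice DM where
  dneg x := (!x.2, !x.1)
  dneg_dneg := by rintro ⟨_ | _, _ | _⟩ <;> rfl
  dneg_sup := by rintro ⟨_ | _, _ | _⟩ ⟨_ | _, _ | _⟩ <;> rfl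
  dneg_inf := by rintro ⟨_ | _, _ | _⟩ ⟨_ | _, _ | _⟩ <;> rfl

theorem eq_t_or_b_iff (x : DM) : (x = t ∨ x = b) ↔ x.1 = true := by
  constructor
  · rintro (rfl | rfl) <;> rfl
  · obtain ⟨_ | _, _ | _⟩ := x
    · exact fun h => absurd h Bool.false_ne_true
    · exact fun h => absurd h Bool.false_ne_true
    · exact fun _ => Or.inr rfl
    · exact fun _ => Or.inl rfl

theorem t_or_b_of_le {x y : DM} (h : x ≤ y) (hx : x = t ∨ x = b) : y = t ∨ y = b := by
  rw [eq_t_or_b_iff] at hx ⊢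
  have h1 : x.1 ≤ y.1 := h.1
  rw [hx] at h1
  exact top_le_iff.mp h1

end DM

instance {ι : Type} : DeMorganLattice (ι → DM) where
  dneg x i := DeMorganLattice.dneg (x i)
  dneg_dneg x := funext fun i => DeMorganLattice.dneg_dneg (x i)
  dneg_sup x y := funext fun i => DeMorganLattice.dneg_sup (x i) (y i)
  dneg_inf x y := funext fun i => DeMorganLattice.dneg_inf (x i) (y i)

/-- The `n`-th dual power of the structure `⟨DM₁, {t, b}⟩`: the universe is the `n`-th direct power
of the four-element De Morgan lattice, and a tuple is designated if some component is in
`{t, b}`. -/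
def dualPower (n : ℕ) : UpsetStructure where
  carrier := Fin n → DM
  nonempty := ⟨fun _ => DM.t⟩
  designated :=
    { carrier := {a | ∃ i, a i = DM.t ∨ a i = DM.b}
      upper' := fun _ _ h ⟨i, hi⟩ => ⟨i, DM.t_or_b_of_le (h i) hi⟩ }

/-- Non-empty subuniverses of a De Morgan lattice. -/
structure Subuniverse (α : Type) [DeMorganLattice α] extends Sublattice α where
  dneg_mem' : ∀ {x : α}, x ∈ carrier → DeMorganLattice.dneg x ∈ carrier
  nonempty' : carrier.Nonempty

instance {α : Type} [DeMorganLattice α] (S : Subuniverse α) :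
    DeMorganLattice S.toSublattice where
  dneg x := ⟨DeMorganLattice.dneg x.1, S.dneg_mem' x.2⟩
  dneg_dneg x := Subtype.ext (DeMorganLattice.dneg_dneg x.1)
  dneg_sup x y := Subtype.ext (DeMorganLattice.dneg_sup x.1 y.1)
  dneg_inf x y := Subtype.ext (DeMorganLattice.dneg_inf x.1 y.1)

/-- The substructure of `M` with a given universe. -/
def UpsetStructure.substructure (M : UpsetStructure) (S : Subuniverse M.carrier) :
    UpsetStructure where
  carrier := S.toSublattice
  nonempty := S.nonempty'.to_subtype
  designated :=
    { carrier := {x | (x : M.carrier) ∈ M.designated}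
      upper' := fun _ _ h hx => M.designated.upper h hx }

/-- `R` is a set of rules which separates `L` from the substructures of the `n`-th dual power of
`⟨DM₁, {t, b}⟩` which are not models of `L`: each rule in `R` is valid in `L`, each rule in `R`
fails in some such substructure, and in each such substructure some rule in `R` fails. -/
structure Logic.IsSeparatingSet (L : Logic) (n : ℕ) (R : Set Rule) : Prop where
  valid : ∀ r ∈ R, L.Validates r
  fails : ∀ r ∈ R, ∃ S : Subuniverse (dualPower n).carrier,
    ¬ ((dualPower n).substructure S).IsModel L ∧
    ¬ ((dualPower n).substructure S).Satisfies (r.premises : Set Formula) r.conclusion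
  separates : ∀ S : Subuniverse (dualPower n).carrier,
    ¬ ((dualPower n).substructure S).IsModel L →
    ∃ r ∈ R, ¬ ((dualPower n).substructure S).Satisfies (r.premises : Set Formula) r.conclusion

end DML

/-! Soundness is routine; completeness rests on prime theories. Let the calculus consist of finitely
many rules for `BDinf`, the `n`-adjunction rule and the disjunctive variants of `R`. Each of its
rules survives disjoining a side formula (`disjClosed_calculus`), so the calculus itself has the
PCP, and an underivable `φ` is avoided by a prime theory `T` containing `Γ` (`exists_prime_theory`).

In the free De Morgan lattice, `T` is an upset whose complement is closed under joins. Its maximal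
filters are prime, and `n`-adjunction allows at most `n` of them, so `T` is a union of `n` prime
filters (`IsNAdjunctive.exists_primeFilters`). These are the coordinates of a valuation in
`dualPower n` that designates exactly the members of `T`. The substructure it generates satisfies
`R`, because `T` is prime, omits `φ` and is closed under the disjunctive variants; hence it is a
model of `L`, and it refutes `Γ ⊢ φ` (`calculus_complete`).

Finiteness of `R` holds because `dualPower n` has finitely many subuniverses and `L` is finitary by
compactness. A bound on the sizes of the generating structures yields `n` by the pigeonhole
principle. -/

namespace DML

open Formula

/-! ## The Lindenbaum algebra of De Morgan lattices -/

namespace Formula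

/-- The order on formulas given by the axioms of De Morgan lattices. -/
inductive DLe : Formula → Formula → Prop
  | refl (a) : DLe a a
  | trans {a b c} : DLe a b → DLe b c → DLe a c
  | conj_left (a b) : DLe (conj a b) a
  | conj_right (a b) : DLe (conj a b) b
  | le_conj {a b c} : DLe c a → DLe c b → DLe c (conj a b)
  | disj_left (a b) : DLe a (disj a b)
  | disj_right (a b) : DLe b (disj a b)
  | disj_le {a b c} : DLe a c → DLe b c → DLe (disj a b) c
  | distrib (a b c) : DLe (conj (disj a b) (disj a c)) (disj a (conj b c))
  | le_neg_neg (a) : DLe a (neg (neg a))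
  | neg_neg_le (a) : DLe (neg (neg a)) a
  | neg_anti {a b} : DLe a b → DLe (neg b) (neg a)

/-- Formulas which are equal in all De Morgan lattices. -/
instance dleSetoid : Setoid Formula where
  r a b := DLe a b ∧ DLe b a
  iseqv := ⟨fun a => ⟨.refl a, .refl a⟩, fun h => ⟨h.2, h.1⟩,
    fun h k => ⟨h.1.trans k.1, k.2.trans h.2⟩⟩

/-- The free De Morgan lattice over countably many generators. -/
def Lindenbaum : Type := Quotient dleSetoid

namespace Lindenbaum

/-- The class of a formula. -/
def mk (a : Formula) : Lindenbaum := Quotient.mk _ a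

instance : DeMorganLattice Lindenbaum where
  le := Quotient.lift₂ DLe fun _ _ _ _ h k =>
    propext ⟨fun l => (h.2.trans l).trans k.1, fun l => (h.1.trans l).trans k.2⟩
  le_refl := by rintro ⟨a⟩; exact .refl a
  le_trans := by rintro ⟨a⟩ ⟨b⟩ ⟨c⟩ h k; exact DLe.trans h k
  le_antisymm := by rintro ⟨a⟩ ⟨b⟩ h k; exact Quotient.sound ⟨h, k⟩
  inf := Quotient.map₂ conj fun _ _ h _ _ k =>
    ⟨.le_conj ((DLe.conj_left _ _).trans h.1) ((DLe.conj_right _ _).trans k.1),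
      .le_conj ((DLe.conj_left _ _).trans h.2) ((DLe.conj_right _ _).trans k.2)⟩
  inf_le_left := by rintro ⟨a⟩ ⟨b⟩; exact .conj_left a b
  inf_le_right := by rintro ⟨a⟩ ⟨b⟩; exact .conj_right a b
  le_inf := by rintro ⟨a⟩ ⟨b⟩ ⟨c⟩ h k; exact DLe.le_conj h k
  sup := Quotient.map₂ disj fun _ _ h _ _ k =>
    ⟨.disj_le (h.1.trans (.disj_left _ _)) (k.1.trans (.disj_right _ _)),
      .disj_le (h.2.trans (.disj_left _ _)) (k.2.trans (.disj_right _ _))⟩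
  le_sup_left := by rintro ⟨a⟩ ⟨b⟩; exact .disj_left a b
  le_sup_right := by rintro ⟨a⟩ ⟨b⟩; exact .disj_right a b
  sup_le := by rintro ⟨a⟩ ⟨b⟩ ⟨c⟩ h k; exact DLe.disj_le h k
  le_sup_inf := by rintro ⟨a⟩ ⟨b⟩ ⟨c⟩; exact .distrib a b c
  dneg := Quotient.map neg fun _ _ h => ⟨.neg_anti h.2, .neg_anti h.1⟩
  dneg_dneg := by rintro ⟨a⟩; exact Quotient.sound ⟨.neg_neg_le a, .le_neg_neg a⟩
  dneg_sup := by
    rintro ⟨a⟩ ⟨b⟩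
    refine Quotient.sound ⟨.le_conj (.neg_anti (.disj_left a b)) (.neg_anti (.disj_right a b)), ?_⟩
    refine (DLe.le_neg_neg _).trans (.neg_anti (.disj_le ?_ ?_))
    · exact (DLe.le_neg_neg a).trans (.neg_anti (.conj_left _ _))
    · exact (DLe.le_neg_neg b).trans (.neg_anti (.conj_right _ _))
  dneg_inf := by
    rintro ⟨a⟩ ⟨b⟩
    refine Quotient.sound
      ⟨?_, .disj_le (.neg_anti (.conj_left a b)) (.neg_anti (.conj_right a b))⟩
    refine (DLe.neg_anti (.le_conj ?_ ?_)).trans (.neg_neg_le _)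
    · exact (DLe.neg_anti (.disj_left _ _)).trans (.neg_neg_le a)
    · exact (DLe.neg_anti (.disj_right _ _)).trans (.neg_neg_le b)

theorem mk_le_mk {a b : Formula} : mk a ≤ mk b ↔ DLe a b := Iff.rfl

theorem mk_surjective : Function.Surjective mk := Quotient.mk_surjective

theorem eval_var (a : Formula) : a.eval (fun i => mk (var i)) = mk a := by
  induction a with
  | var i => rfl
  | conj a b ha hb => rw [eval, ha, hb]; rfl
  | disj a b ha hb => rw [eval, ha, hb]; rfl
  | neg a ha => rw [eval, ha]; rfl

end Lindenbaum

/-- The inequality `a ≤ b` holds in all De Morgan lattices. -/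
def Below (a b : Formula) : Prop :=
  ∀ (A : Type) [DeMorganLattice A] (v : ℕ → A), a.eval v ≤ b.eval v

/-- Under the generic valuation in the free algebra, every formula evaluates to its own class. -/
theorem Below.dle {a b : Formula} (h : Below a b) : DLe a b := by
  have := h Lindenbaum fun i => .mk (var i)
  rwa [Lindenbaum.eval_var, Lindenbaum.eval_var, Lindenbaum.mk_le_mk] at this

end Formula

theorem DeMorganLattice.dneg_le_dneg {A : Type} [DeMorganLattice A] {x y : A} (h : x ≤ y) :
    DeMorganLattice.dneg y ≤ DeMorganLattice.dneg x := by
  rw [← inf_eq_left, ← DeMorganLattice.dneg_sup, sup_eq_left.2 h]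

/-! ## Hilbert-style calculi -/

namespace HilbertDerivable

variable {H : Set Rule} {Γ Δ : Set Formula} {φ : Formula}

theorem cut (h : HilbertDerivable H Δ φ) (hΔ : ∀ δ ∈ Δ, HilbertDerivable H Γ δ) :
    HilbertDerivable H Γ φ := by
  induction h with
  | premise h => exact hΔ _ h
  | apply r σ hr _ ih => exact .apply r σ hr ih

theorem mono_rules {H' : Set Rule} (h : HilbertDerivable H Γ φ) (hH : H ⊆ H') :
    HilbertDerivable H' Γ φ := by
  induction h with
  | premise h => exact .premise h
  | apply r σ hr _ ih => exact .apply r σ (hH hr) ih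

theorem entails {L : Logic} (hL : ∀ r ∈ H, L.Validates r) (h : HilbertDerivable H Γ φ) :
    L.Entails Γ φ := by
  induction h with
  | premise h => exact L.refl h
  | apply r σ hr _ ih =>
    refine L.cut ?_ (L.structural σ (hL r hr))
    rintro _ ⟨γ, hγ, rfl⟩
    exact ih γ hγ

end HilbertDerivable

/-! ## A finite Hilbert-style calculus for `BD_∞` -/

/-- The rule with a single premise `p.1` and the conclusion `p.2`. -/
def Rule.unary (p : Formula × Formula) : Rule := ⟨{p.1}, p.2⟩

namespace BDBasis

/-- The formula `(a ∧ z) ∨ w`. -/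
def ctx (a z w : Formula) : Formula := disj (conj a z) w

/-- Inequalities which, together with their contrapositives, are used in the context
`(_ ∧ x₃) ∨ x₄`. -/
def basicPairs : List (Formula × Formula) :=
  [(conj (var 0) (var 1), var 0), (conj (var 0) (var 1), var 1),
   (var 0, disj (var 0) (var 1)), (var 1, disj (var 0) (var 1)),
   (conj (disj (var 0) (var 1)) (disj (var 0) (var 2)),
     disj (var 0) (conj (var 1) (var 2))),
   (var 0, neg (neg (var 0))), (neg (neg (var 0)), var 0)]

/-- Inequalities which are used to manipulate contexts. -/
def contextPairs : List (Formula × Formula) :=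
  [(ctx (var 0) (var 3) (var 4), ctx (var 0) (conj (var 0) (var 3)) (var 4)),
   (ctx (var 0) (conj (var 1) (var 3)) (var 4), ctx (var 1) (conj (var 0) (var 3)) (var 4)),
   (ctx (var 1) (conj (var 0) (var 3)) (var 4), ctx (conj (var 0) (var 1)) (var 3) (var 4)),
   (ctx (neg (var 1)) (conj (neg (var 0)) (var 3)) (var 4),
     ctx (neg (disj (var 0) (var 1))) (var 3) (var 4)),
   (ctx (disj (var 0) (var 1)) (var 3) (var 4),
     ctx (var 0) (var 3) (ctx (var 1) (var 3) (var 4))),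
   (ctx (neg (conj (var 0) (var 1))) (var 3) (var 4),
     ctx (neg (var 0)) (var 3) (ctx (neg (var 1)) (var 3) (var 4))),
   (ctx (var 0) (var 3) (ctx (var 1) (var 3) (var 4)),
     ctx (var 1) (var 3) (ctx (var 0) (var 3) (var 4))),
   (ctx (var 0) (var 3) (ctx (var 0) (var 3) (var 4)), ctx (var 0) (var 3) (var 4)),
   (var 0, ctx (var 0) (var 0) (var 1)),
   (ctx (var 1) (var 0) (var 1), var 1)]

/-- All inequalities which yield a rule of the calculus. -/
def pairs : List (Formula × Formula) :=
  basicPairs.map (fun p => (ctx p.1 (var 3) (var 4), ctx p.2 (var 3) (var 4))) ++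
  basicPairs.map (fun p => (ctx (neg p.2) (var 3) (var 4), ctx (neg p.1) (var 3) (var 4))) ++
  contextPairs

/-- The rules of the calculus. -/
def rules : Set Rule := Rule.unary '' {p | p ∈ pairs}

theorem rules_finite : rules.Finite := (List.finite_toSet pairs).image _

theorem basicPairs_below : ∀ p ∈ basicPairs, Below p.1 p.2 := by
  simp only [basicPairs, List.forall_mem_cons, List.not_mem_nil, false_imp_iff, implies_true,
    and_true]
  refine ⟨?_, ?_, ?_, ?_, ?_, ?_, ?_⟩ <;> intro A _ v <;>
    simp [eval, DeMorganLattice.dneg_dneg, sup_inf_left]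

theorem contextPairs_below : ∀ p ∈ contextPairs, Below p.1 p.2 := by
  simp only [contextPairs, List.forall_mem_cons, List.not_mem_nil, false_imp_iff, implies_true,
    and_true]
  refine ⟨?_, ?_, ?_, ?_, ?_, ?_, ?_, ?_, ?_, ?_⟩ <;> intro A _ v <;>
    simp only [eval, ctx, DeMorganLattice.dneg_sup, DeMorganLattice.dneg_inf]
  · rw [← inf_assoc, inf_idem]
  · rw [inf_left_comm]
  · rw [inf_left_comm, inf_assoc]
  · rw [inf_left_comm, inf_assoc]
  · rw [inf_sup_right, sup_assoc]
  · rw [inf_sup_right, sup_assoc]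
  · rw [sup_left_comm]
  · rw [← sup_assoc, sup_idem]
  · rw [inf_idem]; exact le_sup_left
  · exact sup_le inf_le_left le_rfl

theorem pairs_below : ∀ p ∈ pairs, Below p.1 p.2 := by
  intro p hp
  simp only [pairs, List.mem_append, List.mem_map] at hp
  rcases hp with (⟨q, hq, rfl⟩ | ⟨q, hq, rfl⟩) | hp
  · intro A _ v
    exact sup_le_sup_right (inf_le_inf_right _ (basicPairs_below q hq A v)) _
  · intro A _ v
    exact sup_le_sup_right (inf_le_inf_right _
      (DeMorganLattice.dneg_le_dneg (basicPairs_below q hq A v))) _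
  · exact contextPairs_below p hp

theorem rules_valid : ∀ r ∈ rules, BDinf.Validates r := by
  rintro _ ⟨p, hp, rfl⟩ M - v hv
  exact M.designated.upper (pairs_below p hp M.carrier v) (hv _ (by simp [Rule.unary]))

/-- The substitution which maps the first variables to the formulas of a list. -/
def inst (l : List Formula) (i : ℕ) : Formula := l.getD i (var 0)

variable {Γ : Set Formula}

theorem step {p : Formula × Formula} (hp : p ∈ pairs) (l : List Formula)
    (h : HilbertDerivable rules Γ (p.1.subst (inst l))) :
    HilbertDerivable rules Γ (p.2.subst (inst l)) :=
  .apply (Rule.unary p) (inst l) ⟨p, hp, rfl⟩ fun γ hγ => by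
    rw [Rule.unary, Finset.mem_singleton] at hγ
    exact hγ ▸ h

theorem step_basic (i : ℕ) (hi : i < basicPairs.length) (l : List Formula)
    (h : HilbertDerivable rules Γ
      (ctx (basicPairs[i].1.subst (inst l)) (inst l 3) (inst l 4))) :
    HilbertDerivable rules Γ (ctx (basicPairs[i].2.subst (inst l)) (inst l 3) (inst l 4)) :=
  step (p := (ctx basicPairs[i].1 (var 3) (var 4), ctx basicPairs[i].2 (var 3) (var 4)))
    (List.mem_append_left _ (List.mem_append_left _
      (List.mem_map_of_mem (List.getElem_mem hi)))) l h

theorem step_basic_neg (i : ℕ) (hi : i < basicPairs.length) (l : List Formula)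
    (h : HilbertDerivable rules Γ
      (ctx (neg (basicPairs[i].2.subst (inst l))) (inst l 3) (inst l 4))) :
    HilbertDerivable rules Γ
      (ctx (neg (basicPairs[i].1.subst (inst l))) (inst l 3) (inst l 4)) :=
  step (p := (ctx (neg basicPairs[i].2) (var 3) (var 4), ctx (neg basicPairs[i].1) (var 3) (var 4)))
    (List.mem_append_left _ (List.mem_append_right _
      (List.mem_map_of_mem (List.getElem_mem hi)))) l h

theorem step_context (i : ℕ) (hi : i < contextPairs.length) (l : List Formula)
    (h : HilbertDerivable rules Γ (contextPairs[i].1.subst (inst l))) :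
    HilbertDerivable rules Γ (contextPairs[i].2.subst (inst l)) :=
  step (List.mem_append_right _ (List.getElem_mem hi)) l h

/-- `b` is derivable from `a` inside every context. -/
def CtxLe (a b : Formula) : Prop :=
  ∀ (Γ : Set Formula) (z w : Formula),
    HilbertDerivable rules Γ (ctx a z w) → HilbertDerivable rules Γ (ctx b z w)

theorem CtxLe.basic (i : ℕ) (hi : i < basicPairs.length) (a b c : Formula) :
    CtxLe (basicPairs[i].1.subst (inst [a, b, c])) (basicPairs[i].2.subst (inst [a, b, c])) ∧
    CtxLe (neg (basicPairs[i].2.subst (inst [a, b, c])))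
      (neg (basicPairs[i].1.subst (inst [a, b, c]))) := by
  -- The basic inequalities use only `x₀, x₁, x₂`, so the entries `z, w` for the context variables
  -- `x₃, x₄` do not affect them.
  have key : ∀ z w p, p ∈ basicPairs →
      p.1.subst (inst [a, b, c, z, w]) = p.1.subst (inst [a, b, c]) ∧
      p.2.subst (inst [a, b, c, z, w]) = p.2.subst (inst [a, b, c]) := by
    intro z w
    simp only [basicPairs, List.forall_mem_cons, List.not_mem_nil, false_imp_iff, implies_true,
      and_true]
    refine ⟨?_, ?_, ?_, ?_, ?_, ?_, ?_⟩ <;> exact ⟨rfl, rfl⟩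
  constructor
  · intro Γ z w h
    obtain ⟨h1, h2⟩ := key z w _ (List.getElem_mem hi)
    have := step_basic (Γ := Γ) i hi [a, b, c, z, w]
    rw [h1, h2] at this
    exact this h
  · intro Γ z w h
    obtain ⟨h1, h2⟩ := key z w _ (List.getElem_mem hi)
    have := step_basic_neg (Γ := Γ) i hi [a, b, c, z, w]
    rw [h1, h2] at this
    exact this h

/-- No rule joins two premises, so `c` is first copied into the context: `c ∧ (c ∧ z)` becomes `a ∧
(c ∧ z)`, then `c ∧ (a ∧ z)`, then `b ∧ (a ∧ z)`. The hypothesis `hd` serves both `d = a ∧ b` and,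
for negated formulas, the negation of a join. -/
theorem CtxLe.meet {a b c d : Formula} (ha : CtxLe c a) (hb : CtxLe c b)
    (hd : ∀ (Γ : Set Formula) (z w : Formula), HilbertDerivable rules Γ (ctx b (conj a z) w) →
      HilbertDerivable rules Γ (ctx d z w)) : CtxLe c d := fun Γ z w h =>
  hd Γ z w <| hb Γ _ w <|
    step_context 1 (by decide) [a, c, c, z, w] <| ha Γ _ w <|
      step_context 0 (by decide) [c, c, c, z, w] h

/-- Dual to `CtxLe.meet`: the two disjuncts are treated one after the other, each with the other
kept in the side disjunct, and the two copies of `c` are then contracted. -/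
theorem CtxLe.join {a b c d : Formula} (ha : CtxLe a c) (hb : CtxLe b c)
    (hd : ∀ (Γ : Set Formula) (z w : Formula), HilbertDerivable rules Γ (ctx d z w) →
      HilbertDerivable rules Γ (ctx a z (ctx b z w))) : CtxLe d c := fun Γ z w h =>
  step_context 7 (by decide) [c, c, c, z, w] <| hb Γ z _ <|
    step_context 6 (by decide) [c, b, c, z, w] <| ha Γ z _ <| hd Γ z w h

/-- The contrapositive is carried through the induction because `DLe.neg_anti` exchanges the two
halves, up to double negation. -/
theorem CtxLe.of_dle {a b : Formula} (h : DLe a b) : CtxLe a b ∧ CtxLe (neg b) (neg a) := by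
  induction h with
  | refl a => exact ⟨fun _ _ _ h => h, fun _ _ _ h => h⟩
  | trans _ _ h k =>
    exact ⟨fun Γ z w l => k.1 Γ z w (h.1 Γ z w l), fun Γ z w l => h.2 Γ z w (k.2 Γ z w l)⟩
  | conj_left a b => exact CtxLe.basic 0 (by decide) a b a
  | conj_right a b => exact CtxLe.basic 1 (by decide) a b a
  | @le_conj a b c _ _ ha hb =>
    exact ⟨ha.1.meet hb.1 fun Γ z w => step_context 2 (by decide) [a, b, a, z, w],
      ha.2.join hb.2 fun Γ z w => step_context 5 (by decide) [a, b, a, z, w]⟩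
  | disj_left a b => exact CtxLe.basic 2 (by decide) a b a
  | disj_right a b => exact CtxLe.basic 3 (by decide) a b a
  | @disj_le a b c _ _ ha hb =>
    exact ⟨ha.1.join hb.1 fun Γ z w => step_context 4 (by decide) [a, b, a, z, w],
      ha.2.meet hb.2 fun Γ z w => step_context 3 (by decide) [a, b, a, z, w]⟩
  | distrib a b c => exact CtxLe.basic 4 (by decide) a b c
  | le_neg_neg a => exact CtxLe.basic 5 (by decide) a a a
  | neg_neg_le a => exact CtxLe.basic 6 (by decide) a a a
  | @neg_anti a b _ h =>
    exact ⟨h.2, fun Γ z w l => (CtxLe.basic 5 (by decide) b b b).1 Γ z w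
      (h.1 Γ z w ((CtxLe.basic 6 (by decide) a a a).1 Γ z w l))⟩

/-- A formula enters and leaves contexts via `a ⊢ (a ∧ a) ∨ b ⊢ (b ∧ a) ∨ b ⊢ b`. -/
theorem derivable_of_dle {a b : Formula} (h : DLe a b) (ha : HilbertDerivable rules Γ a) :
    HilbertDerivable rules Γ b :=
  step_context 9 (by decide) [a, b] <| (CtxLe.of_dle h).1 Γ a b <|
    step_context 8 (by decide) [a, b] ha

theorem isAxiomatizedBy : BDinf.IsAxiomatizedBy rules := by
  refine fun Γ φ => ⟨fun h => ?_, HilbertDerivable.entails rules_valid⟩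
  -- The classes of the formulas derivable from `Γ` form an upset of the free algebra, which refutes
  -- every underivable `φ` under the generic valuation.
  let F : UpperSet Lindenbaum :=
    { carrier := {x | ∃ a, Lindenbaum.mk a = x ∧ HilbertDerivable rules Γ a}
      upper' := by
        rintro _ ⟨b⟩ hab ⟨a, rfl, ha⟩
        exact ⟨b, rfl, derivable_of_dle hab ha⟩ }
  have hF : ∀ a, Lindenbaum.mk a ∈ F ↔ HilbertDerivable rules Γ a := by
    refine fun a => ⟨?_, fun h => ⟨a, rfl, h⟩⟩
    rintro ⟨b, hb, h⟩
    exact derivable_of_dle (Lindenbaum.mk_le_mk.1 hb.le) h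
  have := h { carrier := Lindenbaum, nonempty := ⟨.mk (var 0)⟩, designated := F } trivial
    (fun i => .mk (var i))
  rw [Lindenbaum.eval_var] at this
  refine (hF φ).1 (this fun γ hγ => ?_)
  rw [Lindenbaum.eval_var]
  exact (hF γ).2 (.premise hγ)

theorem derivable_of_below {H : Set Rule} (hH : rules ⊆ H) {a b : Formula} (h : Below a b)
    (ha : HilbertDerivable H Γ a) : HilbertDerivable H Γ b :=
  ((derivable_of_dle h.dle (.premise rfl : HilbertDerivable rules {a} a)).mono_rules hH).cut
    fun _ hδ => hδ ▸ ha

end BDBasis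

/-! ## The `n`-adjunction rule -/

namespace Formula

variable {A : Type} [DeMorganLattice A]

theorem le_eval_bigConj {l : List ℕ} (hl : l ≠ []) (v : ℕ → A) (c : A) :
    c ≤ (bigConj (l.map var)).eval v ↔ ∀ j ∈ l, c ≤ v j := by
  induction l with
  | nil => exact absurd rfl hl
  | cons i l ih =>
    cases l with
    | nil => simp [bigConj, eval]
    | cons k l =>
      have := ih (by simp)
      simp only [List.map_cons, bigConj, eval, le_inf_iff, List.forall_mem_cons] at this ⊢
      rw [this]

theorem eval_bigConj_sup {l : List ℕ} (hl : l ≠ []) (v : ℕ → A) (c : A) :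
    (bigConj (l.map var)).eval (fun i => v i ⊔ c) = (bigConj (l.map var)).eval v ⊔ c := by
  induction l with
  | nil => exact absurd rfl hl
  | cons i l ih =>
    cases l with
    | nil => simp [bigConj, eval]
    | cons k l =>
      have := ih (by simp)
      simp only [List.map_cons, bigConj, eval] at this ⊢
      rw [this, sup_inf_right]

theorem subst_congr {σ τ : ℕ → Formula} {φ : Formula} (h : ∀ i ∈ φ.vars, σ i = τ i) :
    φ.subst σ = φ.subst τ := by
  induction φ with
  | var i => exact h i (by simp [vars])
  | conj a b ha hb =>
    simp only [vars, Finset.mem_union] at h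
    simp only [subst, ha fun i hi => h i (.inl hi), hb fun i hi => h i (.inr hi)]
  | disj a b ha hb =>
    simp only [vars, Finset.mem_union] at h
    simp only [subst, ha fun i hi => h i (.inl hi), hb fun i hi => h i (.inr hi)]
  | neg a ha => simp only [subst, ha h]

end Formula

namespace Rule

/-- The `i`-th premise of the `n`-adjunction rule. -/
def adjPremise (n i : ℕ) : Formula :=
  bigConj (((List.range (n + 1)).eraseIdx i).map var)

theorem mem_nAdjunction_premises {n : ℕ} {γ : Formula} :
    γ ∈ (nAdjunction n).premises ↔ ∃ i < n + 1, adjPremise n i = γ := by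
  simp only [nAdjunction, adjPremise, List.eraseIdx_map, Finset.mem_image, Finset.mem_range]

theorem mem_eraseIdx_range {n i j : ℕ} :
    j ∈ (List.range (n + 1)).eraseIdx i ↔ j < n + 1 ∧ j ≠ i := by
  rw [List.mem_eraseIdx_iff_getElem]
  simp only [List.getElem_range, List.length_range]
  exact ⟨fun ⟨k, h, hk, e⟩ => e ▸ ⟨h, hk⟩, fun ⟨h, hk⟩ => ⟨j, h, hk, rfl⟩⟩

theorem eraseIdx_range_ne_nil {n : ℕ} (hn : 1 ≤ n) (i : ℕ) :
    (List.range (n + 1)).eraseIdx i ≠ [] := by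
  by_cases h : i = 0
  · exact List.ne_nil_of_mem (mem_eraseIdx_range.2 (⟨by omega, by omega⟩ : 1 < n + 1 ∧ 1 ≠ i))
  · exact List.ne_nil_of_mem (mem_eraseIdx_range.2 (⟨by omega, by omega⟩ : 0 < n + 1 ∧ 0 ≠ i))

variable {A : Type} [DeMorganLattice A] {n : ℕ}

theorem le_eval_adjPremise (hn : 1 ≤ n) (i : ℕ) (v : ℕ → A) (c : A) :
    c ≤ (adjPremise n i).eval v ↔ ∀ j < n + 1, j ≠ i → c ≤ v j := by
  rw [adjPremise, le_eval_bigConj (eraseIdx_range_ne_nil hn i)]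
  simp only [mem_eraseIdx_range, and_imp]

theorem le_eval_nAdjunction (v : ℕ → A) (c : A) :
    c ≤ (nAdjunction n).conclusion.eval v ↔ ∀ j < n + 1, c ≤ v j := by
  rw [nAdjunction, le_eval_bigConj (by simp)]
  simp only [List.mem_range]

/-- The `n`-adjunction rule holds in structures with at most `n` elements. -/
theorem satisfies_nAdjunction (hn : 1 ≤ n) (M : UpsetStructure) [Finite M.carrier]
    (hM : Nat.card M.carrier ≤ n) :
    M.Satisfies ((nAdjunction n).premises : Set Formula) (nAdjunction n).conclusion := by
  intro v hv
  have := Fintype.ofFinite M.carrier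
  -- The `n + 1` premises take at most `n` values. If premises `i ≠ j` coincide, their common value
  -- is also below `v i`, hence below the whole meet.
  obtain ⟨i, j, hij, h⟩ := Fintype.exists_ne_map_eq_of_card_lt
    (fun i : Fin (n + 1) => (adjPremise n i).eval v)
    (by rw [Fintype.card_fin, ← Nat.card_eq_fintype_card]; omega)
  refine M.designated.upper ?_ (hv _ (mem_nAdjunction_premises.2 ⟨i, i.2, rfl⟩))
  refine (le_eval_nAdjunction v _).2 fun k hk => ?_
  by_cases hki : k = i
  · exact h.le.trans
      ((le_eval_adjPremise hn j v _).1 le_rfl k hk fun e => hij (Fin.ext (hki.symm.trans e)))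
  · exact (le_eval_adjPremise hn i v _).1 le_rfl k hk hki

end Rule

/-! ## Prime filters -/

section PrimeFilters

variable {A : Type} [DeMorganLattice A]

/-- Possibly empty lattice filters. -/
def IsLatticeFilter (P : Set A) : Prop := ∀ x y, x ⊓ y ∈ P ↔ x ∈ P ∧ y ∈ P

/-- Possibly empty or improper prime filters. -/
structure IsPrimeFilter (P : Set A) : Prop where
  inf_mem_iff : IsLatticeFilter P
  sup_mem_iff : ∀ x y, x ⊔ y ∈ P ↔ x ∈ P ∨ y ∈ P

/-- Upsets whose complement is closed under joins. -/
structure IsPrimeUpset (T : Set A) : Prop where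
  upper : IsUpperSet T
  mem_or_mem : ∀ x y, x ⊔ y ∈ T → x ∈ T ∨ y ∈ T

theorem IsLatticeFilter.mem_of_le {P : Set A} (h : IsLatticeFilter P) {x y : A} (hxy : x ≤ y)
    (hx : x ∈ P) : y ∈ P :=
  ((h x y).1 (by rwa [inf_eq_left.2 hxy])).2

theorem IsLatticeFilter.exists_le {P : Set A} (h : IsLatticeFilter P) (hP : P.Nonempty)
    {ι : Type} [Finite ι] (g : ι → A) (hg : ∀ i, g i ∈ P) : ∃ c ∈ P, ∀ i, c ≤ g i := by
  classical
  have := Fintype.ofFinite ι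
  suffices ∀ s : Finset ι, ∃ c ∈ P, ∀ i ∈ s, c ≤ g i by
    obtain ⟨c, hc, hcg⟩ := this Finset.univ
    exact ⟨c, hc, fun i => hcg i (Finset.mem_univ i)⟩
  intro s
  induction s using Finset.induction_on with
  | empty => exact ⟨hP.some, hP.some_mem, by simp⟩
  | insert i s _ ih =>
    obtain ⟨c, hc, hcg⟩ := ih
    refine ⟨c ⊓ g i, (h _ _).2 ⟨hc, hg i⟩, fun j hj => ?_⟩
    rcases Finset.mem_insert.1 hj with rfl | hj
    · exact inf_le_right
    · exact inf_le_left.trans (hcg j hj)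

/-- The filter generated by the union of two non-empty filters. -/
theorem IsLatticeFilter.join {P Q : Set A} (hP : IsLatticeFilter P) (hQ : IsLatticeFilter Q) :
    IsLatticeFilter {x | ∃ a ∈ P, ∃ b ∈ Q, a ⊓ b ≤ x} := by
  refine fun x y => ⟨?_, ?_⟩
  · rintro ⟨a, ha, b, hb, h⟩
    exact ⟨⟨a, ha, b, hb, h.trans inf_le_left⟩, ⟨a, ha, b, hb, h.trans inf_le_right⟩⟩
  · rintro ⟨⟨a, ha, b, hb, h⟩, ⟨c, hc, d, hd, k⟩⟩
    refine ⟨a ⊓ c, (hP _ _).2 ⟨ha, hc⟩, b ⊓ d, (hQ _ _).2 ⟨hb, hd⟩, ?_⟩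
    rw [inf_inf_inf_comm]
    exact inf_le_inf h k

theorem isLatticeFilter_Ici (a : A) : IsLatticeFilter (Set.Ici a) := fun _ _ => le_inf_iff

/-- Maximal filters among those contained in a given set. -/
def IsMaximalFilterIn (T P : Set A) : Prop := Maximal (· ∈ {P | IsLatticeFilter P ∧ P ⊆ T}) P

variable {T : Set A}

theorem exists_isMaximalFilterIn (hT : IsUpperSet T) {t : A} (ht : t ∈ T) :
    ∃ P, t ∈ P ∧ IsMaximalFilterIn T P := by
  have hchain : ∀ c ⊆ {P : Set A | IsLatticeFilter P ∧ P ⊆ T}, IsChain (· ⊆ ·) c →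
      IsLatticeFilter (⋃₀ c) := by
    intro c hc hchain x y
    constructor
    · rintro ⟨P, hP, h⟩
      have := ((hc hP).1 x y).1 h
      exact ⟨⟨P, hP, this.1⟩, ⟨P, hP, this.2⟩⟩
    · rintro ⟨⟨P, hP, hx⟩, ⟨Q, hQ, hy⟩⟩
      rcases hchain.total hP hQ with h | h
      · exact ⟨Q, hQ, ((hc hQ).1 x y).2 ⟨h hx, hy⟩⟩
      · exact ⟨P, hP, ((hc hP).1 x y).2 ⟨hx, h hy⟩⟩
  obtain ⟨P, hP, hmax⟩ := zorn_subset_nonempty {P : Set A | IsLatticeFilter P ∧ P ⊆ T}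
    (fun c hc h _ => ⟨⋃₀ c, ⟨hchain c hc h, Set.sUnion_subset fun P hP => (hc hP).2⟩,
      fun P hP => Set.subset_sUnion_of_mem hP⟩) (Set.Ici t)
    ⟨isLatticeFilter_Ici t, fun x hx => hT hx ht⟩
  exact ⟨P, hP (Set.mem_Ici.2 le_rfl), hmax⟩

/-- Otherwise the filter generated by `P ∪ Q` would lie in `T`, and maximality of `P` would force `Q
⊆ P`. -/
theorem IsMaximalFilterIn.exists_inf_notMem {P Q : Set A} (hP : IsMaximalFilterIn T P)
    (hPne : P.Nonempty) (hQ : IsLatticeFilter Q) (hT : IsUpperSet T) (h : ¬ Q ⊆ P) :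
    ∃ a ∈ P, ∃ b ∈ Q, a ⊓ b ∉ T := by
  by_contra! hcon
  refine h fun y hy => ?_
  have hle := hP.2 (y := {x | ∃ a ∈ P, ∃ b ∈ Q, a ⊓ b ≤ x})
    ⟨hP.1.1.join hQ, fun x ⟨a, ha, b, hb, hx⟩ => hT hx (hcon a ha b hb)⟩
    fun x hx => ⟨x, hx, y, hy, inf_le_left⟩
  exact hle ⟨hPne.some, hPne.some_mem, y, hy, inf_le_right⟩

/-- If `x, y ∉ P`, some `a, b ∈ P` have `a ⊓ x, b ⊓ y ∉ T`. Distributing `(a ⊓ b) ⊓ (x ⊔ y) ∈ P ⊆ T`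
contradicts primeness of `T`. -/
theorem IsMaximalFilterIn.isPrimeFilter {P : Set A} (hP : IsMaximalFilterIn T P)
    (hT : IsPrimeUpset T) : IsPrimeFilter P := by
  refine ⟨hP.1.1, fun x y => ⟨fun h => ?_, ?_⟩⟩
  · by_contra! hcon
    have key : ∀ z, z ∉ P → ∃ a ∈ P, a ⊓ z ∉ T := fun z hz => by
      obtain ⟨a, ha, b, hb, hab⟩ := hP.exists_inf_notMem ⟨_, h⟩ (isLatticeFilter_Ici z) hT.upper
        fun h => hz (h (Set.mem_Ici.2 le_rfl))
      exact ⟨a, ha, fun h' => hab (hT.upper (inf_le_inf_left a hb) h')⟩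
    obtain ⟨a, ha, hax⟩ := key x hcon.1
    obtain ⟨b, hb, hby⟩ := key y hcon.2
    have hmem : (a ⊓ b) ⊓ (x ⊔ y) ∈ T :=
      hP.1.2 ((hP.1.1 _ _).2 ⟨(hP.1.1 _ _).2 ⟨ha, hb⟩, h⟩)
    rw [inf_sup_left] at hmem
    rcases hT.mem_or_mem _ _ hmem with h | h
    · exact hax (hT.upper (inf_le_inf_right x inf_le_left) h)
    · exact hby (hT.upper (inf_le_inf_right y inf_le_right) h)
  · rintro (h | h)
    · exact hP.1.1.mem_of_le le_sup_left h
    · exact hP.1.1.mem_of_le le_sup_right h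

/-- The set is closed under the `n`-adjunction rule. -/
def IsNAdjunctive (n : ℕ) (T : Set A) : Prop :=
  ∀ v : ℕ → A, (∀ γ ∈ (Rule.nAdjunction n).premises, γ.eval v ∈ T) →
    (Rule.nAdjunction n).conclusion.eval v ∈ T

/-- An `n`-adjunctive prime upset does not contain `n + 1` distinct maximal filters. -/
theorem IsNAdjunctive.not_injective {n : ℕ} (hn : 1 ≤ n) (hadj : IsNAdjunctive n T)
    (hT : IsPrimeUpset T) (P : Fin (n + 1) → Set A) (hP : ∀ i, IsMaximalFilterIn T (P i)) :
    ¬ Function.Injective P := by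
  intro hinj
  have hsub : ∀ i j, P i ⊆ P j → i = j := fun i j h =>
    hinj (Set.Subset.antisymm h ((hP i).2 (hP j).1 h))
  have hnt : Nontrivial (Fin (n + 1)) := Fin.nontrivial_iff_two_le.2 (by omega)
  have hne : ∀ i, (P i).Nonempty := fun i => by
    rw [Set.nonempty_iff_ne_empty]
    intro h
    obtain ⟨j, hj⟩ := exists_ne i
    exact hj (hsub i j (h ▸ Set.empty_subset _)).symm
  have hex : ∀ i j, ∃ a ∈ P i, ∃ b ∈ P j, i ≠ j → a ⊓ b ∉ T := fun i j => by
    by_cases hij : i = j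
    · exact ⟨_, (hne i).some_mem, _, (hne j).some_mem, fun h => absurd hij h⟩
    · obtain ⟨a, ha, b, hb, h⟩ := (hP i).exists_inf_notMem (hne i) (hP j).1.1 hT.upper
        fun h => hij (hsub j i h).symm
      exact ⟨a, ha, b, hb, fun _ => h⟩
  choose a ha b hb hab using hex
  have hc : ∀ i, ∃ c ∈ P i, ∀ j, c ≤ a i j ⊓ b j i := fun i =>
    (hP i).1.1.exists_le (hne i) _ fun j => ((hP i).1.1 _ _).2 ⟨ha i j, hb j i⟩
  choose c hc hcab using hc
  -- Each filter `P i` now has one representative `c i`, and distinct representatives are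
  -- incompatible in `T`.
  have hcc : ∀ i j, i ≠ j → c i ⊓ c j ∉ T := fun i j hij h =>
    hab i j hij (hT.upper (inf_le_inf ((hcab i j).trans inf_le_left)
      ((hcab j i).trans inf_le_right)) h)
  -- The witness `x j` is the join of all `c i` with `i ≠ j`. Then `c i` lies below the `i`-th
  -- premise of `n`-adjunction at `x`, so the meet of all `x j` is in `T`.
  have hx : ∀ j : ℕ, ∃ x, (∀ i : Fin (n + 1), (i : ℕ) ≠ j → c i ≤ x) ∧
      ∀ Q : Set A, IsPrimeFilter Q → x ∈ Q → ∃ i : Fin (n + 1), (i : ℕ) ≠ j ∧ c i ∈ Q := by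
    intro j
    have hs : (Finset.univ.filter fun i : Fin (n + 1) => (i : ℕ) ≠ j).Nonempty := by
      by_cases hj : j = 0
      · exact ⟨⟨1, by omega⟩, by simp [hj]⟩
      · exact ⟨0, by simpa using Ne.symm hj⟩
    refine ⟨Finset.sup' _ hs c, fun i hi => Finset.le_sup' c (by simpa using hi), fun Q hQ => ?_⟩
    refine Finset.sup'_induction hs c
      (p := fun x => x ∈ Q → ∃ i : Fin (n + 1), (i : ℕ) ≠ j ∧ c i ∈ Q) ?_ ?_
    · intro x hx y hy h
      exact ((hQ.sup_mem_iff x y).1 h).elim hx hy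
    · exact fun i hi h => ⟨i, by simpa using hi, h⟩
  choose x hcx hx using hx
  have hmem : (Rule.nAdjunction n).conclusion.eval x ∈ T := by
    refine hadj x fun γ hγ => ?_
    obtain ⟨i, hi, rfl⟩ := Rule.mem_nAdjunction_premises.1 hγ
    refine hT.upper ?_ ((hP ⟨i, hi⟩).1.2 (hc ⟨i, hi⟩))
    exact (Rule.le_eval_adjPremise hn i x _).2 fun j _ hji => hcx j ⟨i, hi⟩ (Ne.symm hji)
  obtain ⟨Q, hQmem, hQ⟩ := exists_isMaximalFilterIn hT.upper hmem
  have hQp := hQ.isPrimeFilter hT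
  have hxQ : ∀ j < n + 1, x j ∈ Q := fun j hj =>
    hQ.1.1.mem_of_le ((Rule.le_eval_nAdjunction x _).1 le_rfl j hj) hQmem
  -- A prime filter inside `T` containing every `x j` contains some `c i` by `x 0`, and then another
  -- `c k` with `k ≠ i` by `x i`.
  obtain ⟨i, -, hi⟩ := hx 0 Q hQp (hxQ 0 (by omega))
  obtain ⟨k, hki, hk⟩ := hx i Q hQp (hxQ i i.2)
  exact hcc i k (fun e => hki (e ▸ rfl)) (hQ.1.2 ((hQ.1.1 _ _).2 ⟨hi, hk⟩))

/-- An `n`-adjunctive prime upset is the union of `n` prime filters. -/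
theorem IsNAdjunctive.exists_primeFilters {n : ℕ} (hn : 1 ≤ n) (hadj : IsNAdjunctive n T)
    (hT : IsPrimeUpset T) :
    ∃ P : Fin n → Set A, (∀ i, IsPrimeFilter (P i)) ∧ ∀ x, x ∈ T ↔ ∃ i, x ∈ P i := by
  have hcard : {P | IsMaximalFilterIn T P}.encard ≤ n := by
    by_contra! h
    obtain ⟨C, hCm, hc⟩ := Set.exists_subset_encard_eq (k := ((n + 1 : ℕ) : ℕ∞))
      (by push_cast; exact Order.add_one_le_of_lt h)
    have hfin : C.Finite := Set.finite_of_encard_eq_coe hc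
    have := hfin.to_subtype
    have hc' : Nat.card C = n + 1 := by
      rw [Nat.card_coe_set_eq, Set.ncard, hc, ENat.toNat_natCast]
    let e := (Finite.equivFinOfCardEq hc').symm
    exact hadj.not_injective hn hT (fun i => (e i : Set A)) (fun i => hCm (e i).2)
      (Subtype.val_injective.comp e.injective)
  have hfin := Set.finite_of_encard_le_coe hcard
  have := hfin.to_subtype
  let e := Finite.equivFin {P | IsMaximalFilterIn T P}
  have hm : Nat.card {P | IsMaximalFilterIn T P} ≤ n := by
    rw [Nat.card_coe_set_eq]
    rw [← hfin.cast_ncard_eq] at hcard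
    exact_mod_cast hcard
  classical
  -- If there are fewer than `n` maximal filters, the list is padded with the empty prime filter.
  refine ⟨fun i => if h : (i : ℕ) < Nat.card {P | IsMaximalFilterIn T P} then
    (e.symm ⟨i, h⟩ : Set A) else ∅, fun i => ?_, fun x => ⟨fun hx => ?_, ?_⟩⟩
  · dsimp only
    split_ifs with h
    · exact (e.symm ⟨i, h⟩).2.isPrimeFilter hT
    · exact ⟨fun _ _ => by simp, fun _ _ => by simp⟩
  · obtain ⟨P, hxP, hP⟩ := exists_isMaximalFilterIn hT.upper hx
    refine ⟨⟨e ⟨P, hP⟩, (e ⟨P, hP⟩).2.trans_le hm⟩, ?_⟩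
    have he : e.symm ⟨e ⟨P, hP⟩, (e ⟨P, hP⟩).2⟩ = ⟨P, hP⟩ := e.symm_apply_apply _
    simpa only [Fin.is_lt, dite_true, he] using hxP
  · rintro ⟨i, hi⟩
    dsimp only at hi
    split_ifs at hi with h
    · exact (e.symm ⟨i, h⟩).2.1.2 hi
    · exact hi.elim

end PrimeFilters

/-! ## Prime theories -/

/-- Every rule of the calculus has a derivable disjunctive variant. -/
def DisjClosed (H : Set Rule) : Prop :=
  ∀ r ∈ H, ∀ (σ : ℕ → Formula) (χ : Formula) (Γ : Set Formula),
    (∀ γ ∈ r.premises, HilbertDerivable H Γ (disj (γ.subst σ) χ)) →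
      HilbertDerivable H Γ (disj (r.conclusion.subst σ) χ)

theorem BDBasis.disj_derivable {H : Set Rule} (hH : BDBasis.rules ⊆ H) {r : Rule}
    (hr : r ∈ BDBasis.rules) (σ : ℕ → Formula) (χ : Formula) (Γ : Set Formula)
    (h : ∀ γ ∈ r.premises, HilbertDerivable H Γ (disj (γ.subst σ) χ)) :
    HilbertDerivable H Γ (disj (r.conclusion.subst σ) χ) := by
  obtain ⟨p, hp, rfl⟩ := hr
  refine derivable_of_below hH ?_ (h p.1 (by simp [Rule.unary]))
  intro A _ v
  simp only [eval, eval_subst, Rule.unary]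
  exact sup_le_sup_right (pairs_below p hp A _) _

/-- By distributivity, substituting `σ i ∨ χ` for each variable turns a meet `m` into `m ∨ χ`; the
rule is thus its own disjunctive variant. -/
theorem Rule.nAdjunction_disj_derivable {H : Set Rule} (hH : BDBasis.rules ⊆ H) {n : ℕ}
    (hn : 1 ≤ n) (hr : nAdjunction n ∈ H) (σ : ℕ → Formula) (χ : Formula) (Γ : Set Formula)
    (h : ∀ γ ∈ (nAdjunction n).premises, HilbertDerivable H Γ (disj (γ.subst σ) χ)) :
    HilbertDerivable H Γ (disj ((nAdjunction n).conclusion.subst σ) χ) := by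
  have key : ∀ l : List ℕ, l ≠ [] → ∀ (A : Type) [DeMorganLattice A] (v : ℕ → A),
      ((bigConj (l.map var)).subst fun i => disj (σ i) χ).eval v =
        (disj ((bigConj (l.map var)).subst σ) χ).eval v := by
    intro l hl A _ v
    simp only [eval, eval_subst]
    exact eval_bigConj_sup hl _ _
  have h1 : HilbertDerivable H Γ ((nAdjunction n).conclusion.subst fun i => disj (σ i) χ) := by
    refine .apply _ _ hr fun γ hγ => ?_
    have hd := h γ hγ
    obtain ⟨i, -, rfl⟩ := mem_nAdjunction_premises.1 hγ
    exact BDBasis.derivable_of_below hH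
      (fun A _ v => (key _ (eraseIdx_range_ne_nil hn i) A v).ge) hd
  exact BDBasis.derivable_of_below hH
    (fun A _ v => (key (List.range (n + 1)) (by simp) A v).le) h1

/-- The fresh variable absorbs `χ` by associativity. -/
theorem Rule.disjVariant_disj_derivable {H : Set Rule} (hH : BDBasis.rules ⊆ H) {r : Rule}
    (hr : r.disjVariant ∈ H) (σ : ℕ → Formula) (χ : Formula) (Γ : Set Formula)
    (h : ∀ γ ∈ r.disjVariant.premises, HilbertDerivable H Γ (disj (γ.subst σ) χ)) :
    HilbertDerivable H Γ (disj (r.disjVariant.conclusion.subst σ) χ) := by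
  have key : ∀ φ : Formula, φ.vars ⊆ r.vars →
      (disj φ (var r.freshVar)).subst
        (Function.update σ r.freshVar (disj (σ r.freshVar) χ)) =
      disj (φ.subst σ) (disj (σ r.freshVar) χ) := by
    intro φ hφ
    simp only [subst, Function.update_self]
    congr 1
    refine subst_congr fun i hi => Function.update_of_ne ?_ _ _
    rintro rfl
    exact r.freshVar_notMem_vars (hφ hi)
  have h1 := HilbertDerivable.apply (Γ := Γ) r.disjVariant
    (Function.update σ r.freshVar (disj (σ r.freshVar) χ)) hr fun γ hγ => by
      have hd := h γ hγ
      obtain ⟨δ, hδ, rfl⟩ := Finset.mem_image.1 hγ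
      rw [key δ ((Finset.subset_biUnion_of_mem Formula.vars hδ).trans Finset.subset_union_left)]
      refine BDBasis.derivable_of_below hH (fun A _ v => ?_) hd
      simp only [subst, eval, sup_assoc, le_refl]
  rw [Rule.disjVariant, key _ Finset.subset_union_right] at h1
  refine BDBasis.derivable_of_below hH (fun A _ v => ?_) h1
  simp only [Rule.disjVariant, subst, eval, sup_assoc, le_refl]

/-- The rules of the calculus for `BD_∞`, the `n`-adjunction rule and the disjunctive variants of
the rules in `R`. -/
def calculus (n : ℕ) (R : Set Rule) : Set Rule :=
  BDBasis.rules ∪ insert (Rule.nAdjunction n) (Rule.disjVariant '' R)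

theorem rules_subset_calculus (n : ℕ) (R : Set Rule) : BDBasis.rules ⊆ calculus n R :=
  Set.subset_union_left

theorem nAdjunction_mem_calculus (n : ℕ) (R : Set Rule) : Rule.nAdjunction n ∈ calculus n R :=
  Or.inr (Or.inl rfl)

theorem disjVariant_mem_calculus (n : ℕ) {R : Set Rule} {r : Rule} (hr : r ∈ R) :
    r.disjVariant ∈ calculus n R :=
  Or.inr (Or.inr ⟨r, hr, rfl⟩)

theorem disjClosed_calculus {n : ℕ} (hn : 1 ≤ n) (R : Set Rule) : DisjClosed (calculus n R) := by
  rintro r (hr | rfl | ⟨r, hr, rfl⟩)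
  · exact BDBasis.disj_derivable (rules_subset_calculus n R) hr
  · exact Rule.nAdjunction_disj_derivable (rules_subset_calculus n R) hn
      (nAdjunction_mem_calculus n R)
  · exact Rule.disjVariant_disj_derivable (rules_subset_calculus n R)
      (disjVariant_mem_calculus n hr)

namespace HilbertDerivable

variable {H : Set Rule}

theorem disj_right (hH : DisjClosed H) {Γ Δ : Set Formula} {φ χ : Formula}
    (h : HilbertDerivable H Γ φ) (hΓ : ∀ γ ∈ Γ, HilbertDerivable H Δ (disj γ χ)) :
    HilbertDerivable H Δ (disj φ χ) := by
  induction h with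
  | premise h => exact hΓ _ h
  | apply r σ hr _ ih => exact hH r hr σ χ Δ ih

/-- Disjoining `a` throughout the derivation from `b` gives `φ ∨ a`; disjoining `φ` throughout the
derivation from `a` then gives `φ ∨ φ`. -/
theorem pcp (hB : BDBasis.rules ⊆ H) (hH : DisjClosed H) {Γ : Set Formula} {a b φ : Formula}
    (ha : HilbertDerivable H (insert a Γ) φ) (hb : HilbertDerivable H (insert b Γ) φ) :
    HilbertDerivable H (insert (disj a b) Γ) φ := by
  have hΓ : ∀ c, ∀ γ ∈ Γ, HilbertDerivable H (insert (disj a b) Γ) (disj γ c) := fun c γ hγ =>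
    BDBasis.derivable_of_below hB (fun A _ v => le_sup_left)
      (.premise (Set.mem_insert_of_mem _ hγ))
  have h1 : HilbertDerivable H (insert (disj a b) Γ) (disj φ a) := by
    refine hb.disj_right hH ?_
    rintro γ (rfl | hγ)
    · exact BDBasis.derivable_of_below hB (fun A _ v => (sup_comm _ _).le)
        (.premise (Set.mem_insert _ _))
    · exact hΓ a γ hγ
  have h2 : HilbertDerivable H (insert (disj a b) Γ) (disj φ φ) := by
    refine ha.disj_right hH ?_
    rintro γ (rfl | hγ)
    · exact BDBasis.derivable_of_below hB (fun A _ v => (sup_comm _ _).le) h1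
    · exact hΓ φ γ hγ
  exact BDBasis.derivable_of_below hB (fun A _ v => (sup_idem _).le) h2

end HilbertDerivable

/-- Sets of formulas closed under the rules of a calculus. -/
def IsTheory (H : Set Rule) (T : Set Formula) : Prop :=
  ∀ r ∈ H, ∀ σ : ℕ → Formula, (∀ γ ∈ r.premises, γ.subst σ ∈ T) → r.conclusion.subst σ ∈ T

theorem IsTheory.mem_of_derivable {H : Set Rule} {T : Set Formula} (hT : IsTheory H T)
    {φ : Formula} (h : HilbertDerivable H T φ) : φ ∈ T := by
  induction h with
  | premise h => exact h
  | apply r σ hr _ ih => exact hT r hr σ ih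

theorem isTheory_derivable (H : Set Rule) (Γ : Set Formula) :
    IsTheory H {φ | HilbertDerivable H Γ φ} := fun r hr σ h => .apply r σ hr h

theorem IsTheory.sUnion {H : Set Rule} {c : Set (Set Formula)} (hc : ∀ T ∈ c, IsTheory H T)
    (hchain : IsChain (· ⊆ ·) c) (hne : c.Nonempty) : IsTheory H (⋃₀ c) := by
  intro r hr σ h
  obtain ⟨T, hT, hsub⟩ := hchain.directedOn.exists_mem_subset_of_finite_of_subset_sUnion hne
    (s := (fun γ => γ.subst σ) '' (r.premises : Set Formula)) (r.premises.finite_toSet.image _)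
    (by rintro _ ⟨γ, hγ, rfl⟩; exact h γ hγ)
  exact ⟨T, hT, hc T hT r hr σ fun γ hγ => hsub ⟨γ, hγ, rfl⟩⟩

/-- A formula which is not derivable can be avoided by a prime theory. -/
theorem exists_prime_theory {H : Set Rule} (hB : BDBasis.rules ⊆ H) (hH : DisjClosed H)
    {Γ : Set Formula} {φ : Formula} (h : ¬ HilbertDerivable H Γ φ) :
    ∃ T, Γ ⊆ T ∧ φ ∉ T ∧ IsTheory H T ∧ ∀ a b, disj a b ∈ T → a ∈ T ∨ b ∈ T := by
  obtain ⟨T, hΓ, hT⟩ := zorn_subset_nonempty {T | IsTheory H T ∧ φ ∉ T}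
    (fun c hc hchain hne => ⟨⋃₀ c, ⟨IsTheory.sUnion (fun T hT => (hc hT).1) hchain hne,
      fun ⟨T, hT, hφ⟩ => (hc hT).2 hφ⟩, fun T hT => Set.subset_sUnion_of_mem hT⟩)
    {φ | HilbertDerivable H Γ φ} ⟨isTheory_derivable H Γ, h⟩
  refine ⟨T, fun γ hγ => hΓ (.premise hγ), hT.1.2, hT.1.1, fun a b hab => ?_⟩
  by_contra! hcon
  have key : ∀ c, c ∉ T → HilbertDerivable H (insert c T) φ := by
    intro c hc
    by_contra hcφ
    exact hc (hT.2 (y := {φ | HilbertDerivable H (insert c T) φ}) ⟨isTheory_derivable H _, hcφ⟩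
      (fun x hx => .premise (Set.mem_insert_of_mem _ hx)) (.premise (Set.mem_insert _ _)))
  have := (key a hcon.1).pcp hB hH (key b hcon.2)
  rw [Set.insert_eq_of_mem hab] at this
  exact hT.1.2 (hT.1.1.mem_of_derivable this)

/-! ## Substructures of dual powers -/

namespace UpsetStructure

/-- The subuniverse generated by the values of a valuation. -/
def generated (M : UpsetStructure) (v : ℕ → M.carrier) : Subuniverse M.carrier where
  carrier := Set.range fun a : Formula => a.eval v
  supClosed' := by rintro _ ⟨a, rfl⟩ _ ⟨b, rfl⟩; exact ⟨disj a b, rfl⟩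
  infClosed' := by rintro _ ⟨a, rfl⟩ _ ⟨b, rfl⟩; exact ⟨conj a b, rfl⟩
  dneg_mem' := by rintro _ ⟨a, rfl⟩; exact ⟨neg a, rfl⟩
  nonempty' := ⟨_, var 0, rfl⟩

theorem coe_eval_substructure (M : UpsetStructure) (S : Subuniverse M.carrier)
    (w : ℕ → (M.substructure S).carrier) (a : Formula) :
    (a.eval w).1 = a.eval fun i => (w i).1 := by
  induction a with
  | var i => rfl
  | conj a b ha hb => exact congrArg₂ (fun x y : M.carrier => x ⊓ y) ha hb
  | disj a b ha hb => exact congrArg₂ (fun x y : M.carrier => x ⊔ y) ha hb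
  | neg a ha => exact congrArg (DeMorganLattice.dneg : M.carrier → M.carrier) ha

theorem satisfies_substructure_iff (M : UpsetStructure) (S : Subuniverse M.carrier)
    (Γ : Set Formula) (φ : Formula) :
    (M.substructure S).Satisfies Γ φ ↔ ∀ v : ℕ → M.carrier, (∀ i, v i ∈ S.toSublattice) →
      (∀ γ ∈ Γ, γ.eval v ∈ M.designated) → φ.eval v ∈ M.designated := by
  have key : ∀ (w : ℕ → (M.substructure S).carrier) (a : Formula),
      a.eval w ∈ (M.substructure S).designated ↔
        a.eval (fun i => (w i).1) ∈ M.designated := fun w a => by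
    rw [← coe_eval_substructure]; rfl
  constructor
  · intro h v hv hΓ
    exact (key (fun i => ⟨v i, hv i⟩) φ).1 (h _ fun γ hγ => (key _ γ).2 (hΓ γ hγ))
  · intro h w hΓ
    exact (key w φ).2 (h _ (fun i => (w i).2) fun γ hγ => (key w γ).1 (hΓ γ hγ))

/-- Valuations in the generated subuniverse are exactly substitutions followed by `v`. -/
theorem satisfies_generated_iff (M : UpsetStructure) (v : ℕ → M.carrier)
    (Γ : Set Formula) (φ : Formula) :
    (M.substructure (M.generated v)).Satisfies Γ φ ↔ ∀ σ : ℕ → Formula,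
      (∀ γ ∈ Γ, (γ.subst σ).eval v ∈ M.designated) → (φ.subst σ).eval v ∈ M.designated := by
  rw [satisfies_substructure_iff]
  simp only [eval_subst]
  constructor
  · exact fun h σ hΓ => h _ (fun i => ⟨σ i, rfl⟩) hΓ
  · intro h w hw hΓ
    choose σ hσ using hw
    obtain rfl : (fun i => (σ i).eval v) = w := funext hσ
    exact h σ hΓ

end UpsetStructure

/-! ### From prime theories to valuations in dual powers -/

open Classical in
/-- The valuation in the `n`-th power of the four-element De Morgan lattice given by `n` sets. -/
noncomputable def primeValuation {n : ℕ} (P : Fin n → Set Lindenbaum) (i : ℕ) : (dualPower n).carrier :=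
  -- The second bit records non-membership of the negation, since negation in `DM` swaps and
  -- complements the two bits.
  fun k => ((decide (Lindenbaum.mk (var i) ∈ P k), decide (Lindenbaum.mk (neg (var i)) ∉ P k)) :
    Bool × Bool)

theorem eval_primeValuation {n : ℕ} {P : Fin n → Set Lindenbaum} (hP : ∀ k, IsPrimeFilter (P k))
    (a : Formula) (k : Fin n) :
    ((a.eval (primeValuation P) k).1 = true ↔ Lindenbaum.mk a ∈ P k) ∧
    ((a.eval (primeValuation P) k).2 = true ↔ Lindenbaum.mk (neg a) ∉ P k) := by
  have hinf : ∀ a b : Formula, Lindenbaum.mk (conj a b) = .mk a ⊓ .mk b := fun _ _ => rfl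
  have hsup : ∀ a b : Formula, Lindenbaum.mk (disj a b) = .mk a ⊔ .mk b := fun _ _ => rfl
  have hneg : ∀ a : Formula, Lindenbaum.mk (neg a) = DeMorganLattice.dneg (.mk a) := fun _ => rfl
  induction a with
  | var i => simp [eval, primeValuation]
  | conj a b ha hb =>
    have h1 : ((conj a b).eval (primeValuation P) k).1 =
      ((a.eval (primeValuation P) k).1 && (b.eval (primeValuation P) k).1) := rfl
    have h2 : ((conj a b).eval (primeValuation P) k).2 =
      ((a.eval (primeValuation P) k).2 && (b.eval (primeValuation P) k).2) := rfl
    rw [h1, h2, Bool.and_eq_true, Bool.and_eq_true, ha.1, ha.2, hb.1, hb.2, hneg (conj a b), hinf,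
      DeMorganLattice.dneg_inf, (hP k).sup_mem_iff, (hP k).inf_mem_iff, not_or]
    exact ⟨Iff.rfl, Iff.rfl⟩
  | disj a b ha hb =>
    have h1 : ((disj a b).eval (primeValuation P) k).1 =
      ((a.eval (primeValuation P) k).1 || (b.eval (primeValuation P) k).1) := rfl
    have h2 : ((disj a b).eval (primeValuation P) k).2 =
      ((a.eval (primeValuation P) k).2 || (b.eval (primeValuation P) k).2) := rfl
    rw [h1, h2, Bool.or_eq_true, Bool.or_eq_true, ha.1, ha.2, hb.1, hb.2, hneg (disj a b), hsup,
      DeMorganLattice.dneg_sup, (hP k).sup_mem_iff, (hP k).inf_mem_iff, not_and_or]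
    exact ⟨Iff.rfl, Iff.rfl⟩
  | neg a ha =>
    have h1 : ((neg a).eval (primeValuation P) k).1 = !(a.eval (primeValuation P) k).2 := rfl
    have h2 : ((neg a).eval (primeValuation P) k).2 = !(a.eval (primeValuation P) k).1 := rfl
    rw [h1, h2, hneg (neg a), hneg a, DeMorganLattice.dneg_dneg, Bool.not_eq_true',
      Bool.not_eq_true', ← Bool.not_eq_true, ← Bool.not_eq_true, ha.1, ha.2, not_not, hneg a]
    exact ⟨Iff.rfl, Iff.rfl⟩

theorem eval_primeValuation_mem_designated {n : ℕ} {P : Fin n → Set Lindenbaum}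
    (hP : ∀ k, IsPrimeFilter (P k)) (a : Formula) :
    a.eval (primeValuation P) ∈ (dualPower n).designated ↔ ∃ k, Lindenbaum.mk a ∈ P k := by
  refine exists_congr fun k => ?_
  rw [DM.eq_t_or_b_iff]
  exact (eval_primeValuation hP a k).1

/-- Prime theories closed under the `n`-adjunction rule are determined by valuations in the `n`-th
dual power. -/
theorem exists_dualPower_valuation {H : Set Rule} (hB : BDBasis.rules ⊆ H) {n : ℕ} (hn : 1 ≤ n)
    (hadj : Rule.nAdjunction n ∈ H) {T : Set Formula} (hT : IsTheory H T)
    (hprime : ∀ a b, disj a b ∈ T → a ∈ T ∨ b ∈ T) :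
    ∃ v : ℕ → (dualPower n).carrier, ∀ a, a.eval v ∈ (dualPower n).designated ↔ a ∈ T := by
  have hmk : ∀ a, Lindenbaum.mk a ∈ Lindenbaum.mk '' T ↔ a ∈ T := by
    refine fun a => ⟨?_, fun h => ⟨a, h, rfl⟩⟩
    rintro ⟨b, hb, hab⟩
    exact hT.mem_of_derivable ((BDBasis.derivable_of_dle (Lindenbaum.mk_le_mk.1 hab.le)
      (.premise hb)).mono_rules hB)
  have hup : IsPrimeUpset (Lindenbaum.mk '' T) := by
    constructor
    · rintro _ ⟨b⟩ hab ⟨a, ha, rfl⟩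
      exact ⟨b, hT.mem_of_derivable ((BDBasis.derivable_of_dle (Lindenbaum.mk_le_mk.1 hab)
        (.premise ha)).mono_rules hB), rfl⟩
    · rintro ⟨a⟩ ⟨b⟩ hab
      exact (hprime a b ((hmk (disj a b)).1 hab)).imp (hmk a).2 (hmk b).2
  have hnadj : IsNAdjunctive n (Lindenbaum.mk '' T) := by
    intro v hv
    choose σ hσ using fun i => Lindenbaum.mk_surjective (v i)
    have heval : ∀ a : Formula, a.eval v = .mk (a.subst σ) := fun a => by
      rw [← Lindenbaum.eval_var, eval_subst]
      simp only [Lindenbaum.eval_var, hσ]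
    rw [heval, hmk]
    refine hT _ hadj σ fun γ hγ => ?_
    rw [← hmk, ← heval]
    exact hv γ hγ
  obtain ⟨P, hP, hPT⟩ := hnadj.exists_primeFilters hn hup
  refine ⟨primeValuation P, fun a => ?_⟩
  rw [eval_primeValuation_mem_designated hP, ← hPT, hmk]

/-- Completeness of the calculus. -/
theorem calculus_complete {L : Logic} {n : ℕ} (hn : 1 ≤ n) {R : Set Rule}
    (hR : L.IsSeparatingSet n R) {Γ : Set Formula} {φ : Formula} (h : L.Entails Γ φ) :
    HilbertDerivable (calculus n R) Γ φ := by
  by_contra hφ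
  obtain ⟨T, hΓ, hφT, hT, hprime⟩ :=
    exists_prime_theory (rules_subset_calculus n R) (disjClosed_calculus hn R) hφ
  obtain ⟨v, hv⟩ := exists_dualPower_valuation (rules_subset_calculus n R) hn
    (nAdjunction_mem_calculus n R) hT hprime
  have hmodel : ((dualPower n).substructure ((dualPower n).generated v)).IsModel L := by
    by_contra hcon
    obtain ⟨r, hr, hfail⟩ := hR.separates _ hcon
    refine hfail ((UpsetStructure.satisfies_generated_iff _ _ _ _).2 fun σ hσ => ?_)
    simp only [hv] at hσ ⊢
    have hsubst : ∀ a : Formula, a.vars ⊆ r.vars → (disj a (var r.freshVar)).subst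
        (Function.update σ r.freshVar φ) = disj (a.subst σ) φ := by
      intro a ha
      simp only [subst, Function.update_self]
      congr 1
      refine subst_congr fun i hi => Function.update_of_ne ?_ _ _
      rintro rfl
      exact r.freshVar_notMem_vars (ha hi)
    -- With `φ` as side disjunct, the variant puts the instance of the conclusion, disjoined with
    -- `φ`, into `T`; as `T` is prime and omits `φ`, the instance itself is in `T`.
    have hmem := hT _ (disjVariant_mem_calculus n hr) (Function.update σ r.freshVar φ) ?_
    · rw [Rule.disjVariant, hsubst _ Finset.subset_union_right] at hmem
      exact (hprime _ _ hmem).resolve_right hφT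
    · intro γ hγ
      obtain ⟨δ, hδ, rfl⟩ := Finset.mem_image.1 hγ
      rw [hsubst δ ((Finset.subset_biUnion_of_mem Formula.vars hδ).trans
        Finset.subset_union_left)]
      exact hT.mem_of_derivable (BDBasis.derivable_of_below (rules_subset_calculus n R)
        (fun A _ v => le_sup_left) (.premise (hσ δ hδ)))
  have := (UpsetStructure.satisfies_generated_iff _ _ _ _).1 (hmodel Γ φ h) var
  have hvar : ∀ a : Formula, a.subst var = a := fun a => by
    induction a with
    | var i => rfl
    | conj a b ha hb => rw [subst, ha, hb]
    | disj a b ha hb => rw [subst, ha, hb]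
    | neg a ha => rw [subst, ha]
  simp only [hvar, hv] at this
  exact hφT (this fun γ hγ => hΓ hγ)

/-! ## Finitely generated logics -/

/-- Finite structures satisfy the compactness theorem. -/
theorem UpsetStructure.Satisfies.exists_finset {M : UpsetStructure} [Finite M.carrier]
    {Γ : Set Formula} {φ : Formula} (h : M.Satisfies Γ φ) :
    ∃ Δ : Finset Formula, (Δ : Set Formula) ⊆ Γ ∧ M.Satisfies (Δ : Set Formula) φ := by
  -- With the finite carrier discrete, the space of valuations is compact and evaluation is
  -- continuous.
  let _ : TopologicalSpace M.carrier := ⊥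
  have : DiscreteTopology M.carrier := ⟨rfl⟩
  have hcont : ∀ a : Formula, Continuous fun v : ℕ → M.carrier => a.eval v := fun a => by
    induction a with
    | var i => exact continuous_apply i
    | conj a b ha hb =>
      exact (continuous_of_discreteTopology (f := fun p : M.carrier × M.carrier => p.1 ⊓ p.2)).comp
        (ha.prodMk hb)
    | disj a b ha hb =>
      exact (continuous_of_discreteTopology (f := fun p : M.carrier × M.carrier => p.1 ⊔ p.2)).comp
        (ha.prodMk hb)
    | neg a ha =>
      exact (continuous_of_discreteTopology (f := (DeMorganLattice.dneg : M.carrier → _))).comp ha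
  have hclosed : ∀ (a : Formula) (s : Set M.carrier), IsClosed {v : ℕ → M.carrier | a.eval v ∈ s} :=
    fun a s => (isClosed_discrete s).preimage (hcont a)
  obtain ⟨u, hu⟩ := (hclosed φ (M.designated : Set M.carrier)ᶜ).isCompact.elim_finite_subfamily_closed
    (fun γ : Γ => {v : ℕ → M.carrier | γ.1.eval v ∈ (M.designated : Set M.carrier)})
    (fun γ => hclosed γ _) (by
      rw [Set.eq_empty_iff_forall_notMem]
      rintro v ⟨hv, hΓ⟩
      exact hv (h v fun γ hγ => Set.mem_iInter.1 hΓ ⟨γ, hγ⟩))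
  refine ⟨u.map (Function.Embedding.subtype _), by simp, fun v hv => ?_⟩
  by_contra hcon
  refine Set.eq_empty_iff_forall_notMem.1 hu v ⟨hcon, ?_⟩
  simp only [Set.mem_iInter]
  intro γ hγ
  exact hv γ.1 (by simpa using hγ)

/-- Finitely generated logics are finitary. -/
theorem Logic.IsFinitelyGenerated.exists_finset {L : Logic} (hL : L.IsFinitelyGenerated)
    {Γ : Set Formula} {φ : Formula} (h : L.Entails Γ φ) :
    ∃ Δ : Finset Formula, (Δ : Set Formula) ⊆ Γ ∧ L.Entails (Δ : Set Formula) φ := by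
  classical
  obtain ⟨K, hK, hfin, rfl⟩ := hL
  have hex : ∀ M, ∃ Δ : Finset Formula, (Δ : Set Formula) ⊆ Γ ∧
      (M ∈ K → M.Satisfies (Δ : Set Formula) φ) := fun M => by
    by_cases hM : M ∈ K
    · have := hfin M hM
      obtain ⟨Δ, hΔ, hs⟩ := (h M hM).exists_finset
      exact ⟨Δ, hΔ, fun _ => hs⟩
    · exact ⟨∅, by simp, fun h => absurd h hM⟩
  choose Δ hΔ hs using hex
  refine ⟨hK.toFinset.biUnion Δ, ?_, fun M hM v hv => hs M hM v fun γ hγ => hv γ ?_⟩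
  · intro γ hγ
    obtain ⟨M, -, hM⟩ := Finset.mem_biUnion.1 hγ
    exact hΔ M hM
  · exact Finset.mem_biUnion.2 ⟨M, hK.mem_toFinset.2 hM, hγ⟩

theorem Logic.IsFinitelyGenerated.bdinf_le {L : Logic} (hL : L.IsFinitelyGenerated) :
    BDinf ≤ L := by
  obtain ⟨K, -, -, rfl⟩ := hL
  exact fun Γ φ h M _ => h M trivial

theorem Logic.IsFinitelyGenerated.exists_validates_nAdjunction {L : Logic}
    (hL : L.IsFinitelyGenerated) : ∃ n, 1 ≤ n ∧ L.Validates (Rule.nAdjunction n) := by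
  obtain ⟨K, hK, hfin, rfl⟩ := hL
  obtain ⟨n, hn⟩ := (hK.image fun M => Nat.card M.carrier).bddAbove
  -- The successor ensures `1 ≤ n + 1` even when `K` is empty and the bound is `0`.
  refine ⟨n + 1, by omega, fun M hM => ?_⟩
  have := hfin M hM
  exact Rule.satisfies_nAdjunction (by omega) M ((hn ⟨M, hM, rfl⟩).trans (Nat.le_succ n))

instance {α : Type} [DeMorganLattice α] [Finite α] : Finite (Subuniverse α) :=
  Finite.of_injective (fun S : Subuniverse α => S.carrier) fun S T h => by
    obtain ⟨⟨_, _, _⟩, _, _⟩ := S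
    obtain ⟨⟨_, _, _⟩, _, _⟩ := T
    obtain rfl := h
    rfl

instance (n : ℕ) : Finite (dualPower n).carrier := inferInstanceAs (Finite (Fin n → Bool × Bool))

/-- One rule is chosen for each of the finitely many non-model substructures; finitarity of `L`
trims its premises to a finite set, and the smaller premise set still fails there. -/
theorem Logic.IsFinitelyGenerated.exists_isSeparatingSet {L : Logic} (hL : L.IsFinitelyGenerated)
    (n : ℕ) : ∃ R : Set Rule, R.Finite ∧ L.IsSeparatingSet n R := by
  have hex : ∀ S : {S : Subuniverse (dualPower n).carrier //
      ¬ ((dualPower n).substructure S).IsModel L}, ∃ r : Rule, L.Validates r ∧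
      ¬ ((dualPower n).substructure S).Satisfies (r.premises : Set Formula) r.conclusion := by
    rintro ⟨S, hS⟩
    simp only [UpsetStructure.IsModel, not_forall] at hS
    obtain ⟨Γ, φ, h, hfail⟩ := hS
    obtain ⟨Δ, hΔ, hent⟩ := hL.exists_finset h
    exact ⟨⟨Δ, φ⟩, hent, fun hs => hfail fun v hv => hs v fun γ hγ => hv γ (hΔ hγ)⟩
  choose r hr hfail using hex
  refine ⟨Set.range r, Set.finite_range r, ?_, ?_, ?_⟩
  · rintro _ ⟨S, rfl⟩
    exact hr S
  · rintro _ ⟨S, rfl⟩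
    exact ⟨S, S.2, hfail S⟩
  · exact fun S hS => ⟨_, ⟨⟨S, hS⟩, rfl⟩, hfail ⟨S, hS⟩⟩

/-- In extensions of `BD_∞` with the proof by cases property, disjunctive variants of valid rules
are valid. -/
theorem Logic.PCP.validates_disjVariant {L : Logic} (hL : L.PCP) (hBD : BDinf ≤ L) {r : Rule}
    (hr : L.Validates r) : L.Validates r.disjVariant := by
  classical
  have hsup : ∀ (Γ : Set Formula) (a b : Formula), L.Entails Γ a → L.Entails Γ (disj a b) :=
    fun Γ a b h => L.cut (Δ := {a}) (by rintro _ rfl; exact h) (hBD _ _ fun M _ v hv =>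
      M.designated.upper (show a.eval v ≤ _ from le_sup_left) (hv a rfl))
  -- The premises are weakened one at a time by the PCP; `Δ` holds those not yet weakened while the
  -- induction removes elements of `P`.
  have key : ∀ (χ ψ : Formula), L.Entails {χ} ψ → ∀ (P : Finset Formula) (Δ : Set Formula),
      L.Entails (P ∪ Δ) ψ → L.Entails ((fun γ => disj γ χ) '' (P : Set Formula) ∪ Δ) ψ := by
    intro χ ψ hχ P
    induction P using Finset.induction_on with
    | empty => intro Δ h; simpa using h
    | insert γ P _ ih =>
      intro Δ h
      rw [Finset.coe_insert, Set.image_insert_eq, Set.insert_union]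
      refine hL _ _ _ _ ?_ (L.mono (by simp) hχ)
      rw [← Set.union_insert]
      refine ih _ ?_
      rwa [Set.union_insert, ← Set.insert_union, ← Finset.coe_insert]
  have := key (var r.freshVar) (disj r.conclusion (var r.freshVar))
    (hBD _ _ fun M _ v hv => M.designated.upper
      (show eval v (var r.freshVar) ≤ _ from le_sup_right) (hv _ rfl))
    r.premises ∅ (by rw [Set.union_empty]; exact hsup _ _ _ hr)
  rw [Set.union_empty] at this
  rw [Validates, Rule.disjVariant, Finset.coe_image]
  exact this

end DML

/-! ### The finite basis theorem -/

theorem mainTheorem7 (L : DML.Logic) (hfg : L.IsFinitelyGenerated) (hpcp : L.PCP) :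
    ∃ (B : Set DML.Rule) (n : ℕ) (R : Set DML.Rule),
      B.Finite ∧ DML.BDinf.IsAxiomatizedBy B ∧
      1 ≤ n ∧ R.Finite ∧ L.IsSeparatingSet n R ∧
      L = DML.BDinf.extendBy (insert (DML.Rule.nAdjunction n) (DML.Rule.disjVariant '' R)) ∧
      L.IsAxiomatizedBy (B ∪ insert (DML.Rule.nAdjunction n) (DML.Rule.disjVariant '' R)) := by
  obtain ⟨n, hn, hadj⟩ := hfg.exists_validates_nAdjunction
  obtain ⟨R, hRfin, hR⟩ := hfg.exists_isSeparatingSet n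
  have hvalid : ∀ r ∈ insert (DML.Rule.nAdjunction n) (DML.Rule.disjVariant '' R),
      L.Validates r := by
    rintro r (rfl | ⟨r, hr, rfl⟩)
    · exact hadj
    · exact hpcp.validates_disjVariant hfg.bdinf_le (hR.valid r hr)
  -- Soundness is needed for every such `L'`: with completeness it shows that `L` is the least of
  -- them, and `L' = L` gives the axiomatization.
  have hder : ∀ (L' : DML.Logic), DML.BDinf ≤ L' →
      (∀ r ∈ insert (DML.Rule.nAdjunction n) (DML.Rule.disjVariant '' R), L'.Validates r) →
      ∀ Γ φ, DML.HilbertDerivable (DML.calculus n R) Γ φ → L'.Entails Γ φ := by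
    intro L' hBD hL' Γ φ h
    refine h.entails ?_
    rintro r (hr | hr)
    · exact hBD _ _ (DML.BDBasis.rules_valid r hr)
    · exact hL' r hr
  refine ⟨DML.BDBasis.rules, n, R, DML.BDBasis.rules_finite, DML.BDBasis.isAxiomatizedBy, hn, hRfin,
    hR, ?_, fun Γ φ => ⟨DML.calculus_complete hn hR, hder L hfg.bdinf_le hvalid Γ φ⟩⟩
  ext Γ φ
  exact ⟨fun h L' hBD hL' => hder L' hBD hL' Γ φ (DML.calculus_complete hn hR h),
    fun h => h L hfg.bdinf_le hvalid⟩
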